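/- Let $f_a(z)=az^8+1$ for $a\in\mathbb{C}$ (so $D=8$), with unique critical point $0$ when $a\ne 0$. For $k\ge 2$ and $d\in\{2,4,8\}$ let $R_{k,3,d}$ be the monic polynomial with simple roots whose roots are the parameters $a\in\mathbb{C}$ such that $0$ is preperiodic for $f_a$ with exact preperiod $k$ and exact period $3$, and $f_a^{\circ(k+2)}(0)=\omega f_a^{\circ(k-1)}(0)$ for some primitive $d$-th root of unity $\omega$ (there are finitely many such parameters). For $n\ge 1$ let also $P_n(a)=f_a^{\circ n}(0)\in\mathbb{Z}[a]$ and $R_n=\prod_{m\mid n}P_m^{\mu(n/m)}\in\mathbb{Z}[a]$, where $\mu$ is the Möbius function; thus $R_3=P_3/P_1=P_3=a(a+1)^8+1$. Then, for all $k\ge 2$, the polynomials $R_{k,3,2}$, $R_{k,3,4}$ and $R_{k,3,8}$ have integer coefficients and are irreducible over $\mathbb{Q}$. Moreover, $R_3\equiv 1+a+a^9 \pmod 2$, and this reduction is irreducible over $\mathbb{F}_2$. -/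

import Mathlib

open Polynomial

noncomputable section

namespace Unicritical

/-- The unicritical polynomial map `z ↦ a z ^ D + 1` of `ℂ`. -/
def f (D : ℕ) (a : ℂ) : ℂ → ℂ := fun z => a * z ^ D + 1

/-- `x` is preperiodic for `g`, with (exact) preperiod `k` and (exact) period `n`: the point
`g^[k] x` is periodic of minimal period `n`, and no earlier point of the orbit is periodic. -/
def HasPreperiodPeriod {α : Type*} (g : α → α) (x : α) (k n : ℕ) : Prop :=
  0 < n ∧ Function.minimalPeriod g (g^[k] x) = n ∧
    ∀ j < k, g^[j] x ∉ Function.periodicPts g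

/-- The parameters `a ∈ ℂ` for which `0` is preperiodic for `f D a` with preperiod `k` and
period `n`, and `f_a^{k+n-1}(0) = ω f_a^{k-1}(0)` for some primitive `d`-th root of unity `ω`. -/
def paramSet (D k n d : ℕ) : Set ℂ :=
  {a | HasPreperiodPeriod (f D a) 0 k n ∧
    ∃ ω : ℂ, IsPrimitiveRoot ω d ∧ (f D a)^[k + n - 1] 0 = ω * (f D a)^[k - 1] 0}

/-- `R_{k,n,d}`: the monic polynomial whose (simple) roots are the elements of
`paramSet D k n d`, as a polynomial over `ℂ`. -/
def Rpre (D k n d : ℕ) : ℂ[X] := ∏ᶠ a ∈ paramSet D k n d, (X - C a)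

/-- `P_n(a) = f_a^n(0)`, as a polynomial in `a` with integer coefficients. -/
def P (D n : ℕ) : ℤ[X] := (fun q : ℤ[X] => X * q ^ D + 1)^[n] 0

/-- `R_n = ∏_{m ∣ n} P_m ^ μ(n/m)`: the factors with exponent `1` divided by those with
exponent `-1` (all `P_m` with `m ≥ 1` are monic). -/
def Rper (D n : ℕ) : ℤ[X] :=
  (∏ m ∈ n.divisors with ArithmeticFunction.moebius (n / m) = 1, P D m) /ₘ
    (∏ m ∈ n.divisors with ArithmeticFunction.moebius (n / m) = -1, P D m)

end Unicritical

end

namespace Unicritical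

/-! For `d = 2m`, `m = 2 ^ s`, being a primitive `d`-th root of unity means `ω ^ m = -1`. With
preperiod written `k + 1`, the parameters are therefore roots of `P_{k+3}^m + P_k^m`, minus those
where the period is 1 (roots of `P_{k+1}^m + P_k^m`) or where 0 is periodic (roots of `q = P_3`).
Dividing out these factors leaves a monic `S`, shown irreducible by the generalized Eisenstein
criterion at `(q, 2)`. Modulo 2, Frobenius makes `S` a power of `q`, itself irreducible mod 2
(`P_map_sub`). Modulo `q`, the critical orbit is a 3-cycle, so `S` times the period-1 factor is `2 u
^ m` with `u` a unit (`exists_P_eq_mul`); hence `S` is not in `(q, 4)`. -/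

lemma P_zero (D : ℕ) : P D 0 = 0 := rfl

lemma P_succ (D n : ℕ) : P D (n + 1) = X * P D n ^ D + 1 := by
  simp only [P, Function.iterate_succ_apply']

lemma P_one {D : ℕ} (hD : D ≠ 0) : P D 1 = 1 := by
  rw [P_succ, P_zero, zero_pow hD]; simp

lemma aeval_P (D n : ℕ) (a : ℂ) : aeval a (P D n) = (f D a)^[n] 0 := by
  induction n with
  | zero => simp [P_zero]
  | succ n ih => simp [P_succ, Function.iterate_succ_apply', ih, f]

lemma monic_P_succ_and_natDegree_lt {D : ℕ} (hD : D ≠ 0) (n : ℕ) :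
    (P D (n + 1)).Monic ∧ (P D (n + 1)).natDegree < (P D (n + 2)).natDegree := by
  have key : ∀ p : ℤ[X], p.Monic → (X * p ^ D + 1).Monic ∧
      (X * p ^ D + 1).natDegree = 1 + D * p.natDegree := by
    intro p hp
    have h : (X * p ^ D).Monic := monic_X.mul (hp.pow D)
    have hd : (X * p ^ D).natDegree = 1 + D * p.natDegree := by
      rw [monic_X.natDegree_mul (hp.pow D), hp.natDegree_pow, natDegree_X]
    have hlt : (1 : ℤ[X]).degree < (X * p ^ D).degree := by
      apply degree_lt_degree; rw [hd, natDegree_one]; omega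
    exact ⟨h.add_of_left hlt, by rw [natDegree_add_eq_left_of_degree_lt hlt, hd]⟩
  have hlt (p : ℤ[X]) (hp : p.Monic) : p.natDegree < (X * p ^ D + 1).natDegree := by
    rw [(key p hp).2]
    nlinarith [Nat.pos_of_ne_zero hD]
  induction n with
  | zero => rw [P_succ D 1, P_one hD]; exact ⟨monic_one, hlt 1 monic_one⟩
  | succ n ih =>
    have h : (P D (n + 2)).Monic := by rw [P_succ]; exact (key _ ih.1).1
    exact ⟨h, by rw [P_succ D (n + 2)]; exact hlt _ h⟩

lemma monic_P {D n : ℕ} (hD : D ≠ 0) (hn : n ≠ 0) : (P D n).Monic := by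
  obtain ⟨n, rfl⟩ := Nat.exists_eq_succ_of_ne_zero hn
  exact (monic_P_succ_and_natDegree_lt hD n).1

lemma natDegree_P_lt {D i j : ℕ} (hD : D ≠ 0) (hi : i ≠ 0) (hij : i < j) :
    (P D i).natDegree < (P D j).natDegree := by
  induction j, hij using Nat.le_induction with
  | base =>
    obtain ⟨n, rfl⟩ := Nat.exists_eq_succ_of_ne_zero hi
    exact (monic_P_succ_and_natDegree_lt hD n).2
  | succ j hj ih =>
    obtain ⟨n, rfl⟩ := Nat.exists_eq_succ_of_ne_zero (show j ≠ 0 by omega)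
    exact ih.trans (monic_P_succ_and_natDegree_lt hD n).2

/-- For `i < j`, `P_j ^ m + P_i ^ m` is monic. -/
lemma monic_P_pow_add {D i j m : ℕ} (hD : D ≠ 0) (hi : i ≠ 0) (hij : i < j) (hm : m ≠ 0) :
    (P D j ^ m + P D i ^ m).Monic := by
  have hj := monic_P (D := D) hD (show j ≠ 0 by omega)
  refine (hj.pow m).add_of_left (degree_lt_degree ?_)
  rw [hj.natDegree_pow, (monic_P hD hi).natDegree_pow]
  exact Nat.mul_lt_mul_of_pos_left (natDegree_P_lt hD hi hij) (Nat.pos_of_ne_zero hm)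

lemma P_three : P 8 3 = X * (X + 1) ^ 8 + 1 := by
  rw [P_succ, P_succ, P_one (by norm_num)]; ring

lemma Rper_three : Rper 8 3 = P 8 3 := by
  have h1 : (3 : ℕ).divisors.filter (fun m => ArithmeticFunction.moebius (3 / m) = 1) = {3} := by
    rw [Nat.Prime.divisors Nat.prime_three, Finset.filter_insert, Finset.filter_singleton]
    simp [ArithmeticFunction.moebius_apply_prime Nat.prime_three]
  have h2 : (3 : ℕ).divisors.filter (fun m => ArithmeticFunction.moebius (3 / m) = -1) = {1} := by
    rw [Nat.Prime.divisors Nat.prime_three, Finset.filter_insert, Finset.filter_singleton]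
    simp [ArithmeticFunction.moebius_apply_prime Nat.prime_three]
  rw [Rper, h1, h2, Finset.prod_singleton, Finset.prod_singleton, P_one (by norm_num),
    divByMonic_one]

/-! ### Irreducibility of `P_3` modulo 2 -/

lemma P_three_map :
    (P 8 3).map (Int.castRingHom (ZMod 2)) = 1 + X + X ^ 9 := by
  have h : (X + 1 : (ZMod 2)[X]) ^ 8 = X ^ 8 + 1 := by
    simpa using add_pow_char_pow (p := 2) (n := 3) (X : (ZMod 2)[X]) 1
  simp only [P_three, Polynomial.map_add, Polynomial.map_mul, Polynomial.map_pow, map_X,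
    Polynomial.map_one, h]
  ring

/-- An element `x` of a field with `2 ^ r` elements, `r ≤ 4`, satisfies `x ^ 9 + x + 1 ≠ 0`. -/
lemma one_add_add_pow_nine_ne_zero {F : Type*} [Field F] [CharP F 2] {r : ℕ} (hr : 0 < r)
    (hr' : r ≤ 4) {x : F} (hx : x ^ 2 ^ r = x) : 1 + x + x ^ 9 ≠ 0 := by
  intro h
  have h2 : (2 : F) = 0 := CharP.cast_eq_zero F 2
  have h1 : (1 : F) ≠ 0 := one_ne_zero
  interval_cases r <;> norm_num at hx <;> grind

/-- A proper factorization in degree 9 has a factor of degree at most 4, hence a root in a field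
with `2 ^ r` elements, `r ≤ 4`. -/
lemma irreducible_one_add_X_add_X_pow_nine : Irreducible (1 + X + X ^ 9 : (ZMod 2)[X]) := by
  have hdeg : (1 + X + X ^ 9 : (ZMod 2)[X]).natDegree = 9 := by compute_degree!
  have hmon : (1 + X + X ^ 9 : (ZMod 2)[X]).Monic := by monicity!
  rw [hmon.irreducible_iff_lt_natDegree_lt (fun h => by rw [h] at hdeg; simp at hdeg), hdeg]
  intro g hg hgdeg hdvd
  rw [Finset.mem_Ioc] at hgdeg
  obtain ⟨p, hp, hpg⟩ := WfDvdMonoid.exists_irreducible_factor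
    (not_isUnit_of_natDegree_pos g hgdeg.1) hg.ne_zero
  have : Fact (Irreducible p) := ⟨hp⟩
  have hple := natDegree_le_of_dvd hpg hg.ne_zero
  let B := AdjoinRoot.powerBasis hp.ne_zero
  have : Module.Finite (ZMod 2) (AdjoinRoot p) := B.finite
  have : Finite (AdjoinRoot p) := Module.finite_of_finite (ZMod 2)
  have := Fintype.ofFinite (AdjoinRoot p)
  have : CharP (AdjoinRoot p) 2 := charP_of_injective_algebraMap (algebraMap (ZMod 2) _).injective 2
  have hcard : Fintype.card (AdjoinRoot p) = 2 ^ p.natDegree := by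
    rw [Module.card_eq_pow_finrank (K := ZMod 2), ZMod.card, B.finrank, AdjoinRoot.powerBasis_dim]
  refine one_add_add_pow_nine_ne_zero (F := AdjoinRoot p) (r := p.natDegree)
    hp.natDegree_pos (by omega) (x := AdjoinRoot.root p) ?_ ?_
  · rw [← hcard, FiniteField.pow_card]
  · have h : AdjoinRoot.mk p (1 + X + X ^ 9) = 0 := AdjoinRoot.mk_eq_zero.2 (hpg.trans hdvd)
    simpa using h

/-! ### Eisenstein criterion at `(q, p)` -/

/-- A version of the generalized Eisenstein criterion over `ℤ`. -/
lemma irreducible_of_map_eq_pow {p N : ℕ} [Fact p.Prime] {q S : ℤ[X]} (hq : q.Monic)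
    (hS : S.Monic) (hqirr : Irreducible (q.map (Int.castRingHom (ZMod p)))) (hN : N ≠ 0)
    (hmap : S.map (Int.castRingHom (ZMod p)) = q.map (Int.castRingHom (ZMod p)) ^ N)
    (hne : ∀ s t : ℤ[X], S ≠ q * s + C ((p : ℤ) ^ 2) * t) : Irreducible S := by
  have hker : RingHom.ker (algebraMap ℤ (ZMod p)) = Ideal.span {(p : ℤ)} := by
    rw [algebraMap_int_eq, ZMod.ker_intCastRingHom]
  refine generalizedEisenstein (K := ZMod p) (q := q) (p := N) (by simpa using hqirr) hq
    hS.isPrimitive ?_ (by simp [hS.leadingCoeff]) (by simpa [hS.leadingCoeff] using hmap) ?_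
  · rw [← hS.natDegree_map (Int.castRingHom (ZMod p)), hmap, natDegree_pow]
    exact Nat.mul_pos (Nat.pos_of_ne_zero hN) hqirr.natDegree_pos
  · intro h
    have hdvd : C ((p : ℤ) ^ 2) ∣ S %ₘ q := by
      rw [C_dvd_iff_dvd_coeff]
      intro i
      have hi := congrArg (fun r => coeff r i) h
      simp only [coeff_map, coeff_zero, Ideal.Quotient.eq_zero_iff_mem] at hi
      rwa [hker, Ideal.span_singleton_pow, Ideal.mem_span_singleton] at hi
    obtain ⟨t, ht⟩ := hdvd
    refine hne (S /ₘ q) t ?_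
    rw [← ht, add_comm, modByMonic_add_div]

/-- If `2 v` is congruent to `S T` modulo `q`, where `q` is irreducible modulo `2` and coprime
to `v`, then `S` does not vanish modulo `(q, 4)`. -/
lemma ne_mul_add_of_dvd_sub {q v S T : ℤ[X]}
    (hqirr : Irreducible (q.map (Int.castRingHom (ZMod 2)))) (hqv : IsCoprime q v)
    (h : q ∣ S * T - 2 * v) (s t : ℤ[X]) : S ≠ q * s + C (((2 : ℕ) : ℤ) ^ 2) * t := by
  rintro rfl
  obtain ⟨r, hr⟩ := h
  have h4 : (C (((2 : ℕ) : ℤ) ^ 2) : ℤ[X]) = 4 := by simp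
  rw [h4] at hr
  -- As `q` is nonzero mod 2, the prime 2 divides the cofactor; cancelling it puts `v` in `(q, 2)`,
  -- against coprimality.
  have key : 2 * (v - 2 * t * T) = q * (s * T - r) := by linear_combination -hr
  have h2 : ((2 : ℤ[X]).map (Int.castRingHom (ZMod 2))) = 0 := by
    rw [Polynomial.map_ofNat]; exact CharP.cast_eq_zero (ZMod 2)[X] 2
  have hA : (s * T - r).map (Int.castRingHom (ZMod 2)) = 0 := by
    have := congrArg (Polynomial.map (Int.castRingHom (ZMod 2))) key
    rw [Polynomial.map_mul, h2, zero_mul, Polynomial.map_mul, eq_comm, mul_eq_zero] at this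
    exact this.resolve_left hqirr.ne_zero
  have hA2 : (2 : ℤ[X]) ∣ s * T - r := by
    have : C (2 : ℤ) ∣ s * T - r := by
      rw [C_dvd_iff_dvd_coeff]
      intro i
      have hi := congrArg (fun r => coeff r i) hA
      simp only [coeff_map, coeff_zero, eq_intCast] at hi
      exact (ZMod.intCast_zmod_eq_zero_iff_dvd _ 2).1 hi
    simpa using this
  obtain ⟨w, hw⟩ := hA2
  have hv : v = q * w + 2 * (t * T) := by
    have : (2 : ℤ[X]) * (v - 2 * t * T) = 2 * (q * w) := by rw [key, hw]; ring
    linear_combination mul_left_cancel₀ two_ne_zero this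
  have hdvd : q.map (Int.castRingHom (ZMod 2)) ∣ v.map (Int.castRingHom (ZMod 2)) := by
    rw [hv, Polynomial.map_add, Polynomial.map_mul, Polynomial.map_mul, h2, zero_mul, add_zero]
    exact dvd_mul_right _ _
  exact hqirr.not_isUnit
    ((hqv.map (mapRingHom (Int.castRingHom (ZMod 2)))).isUnit_of_dvd hdvd)

/-! ### The critical orbit modulo 2 and modulo `P_3` -/

/-- Iterates `x ^ 8 - y ^ 8 = (x - y) ^ 8`. Since `e` does not depend on `i`, the powers of `X` for
`i = 1` and `i = 3` cancel in the quotient. -/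
lemma P_map_sub (n : ℕ) : ∃ e : ℕ, ∀ i : ℕ,
    (P 8 (n + i)).map (Int.castRingHom (ZMod 2)) - (P 8 n).map (Int.castRingHom (ZMod 2)) =
      X ^ e * (P 8 i).map (Int.castRingHom (ZMod 2)) ^ 8 ^ n := by
  induction n with
  | zero => exact ⟨0, fun i => by simp [P_zero]⟩
  | succ n ih =>
    obtain ⟨e, he⟩ := ih
    refine ⟨8 * e + 1, fun i => ?_⟩
    have h : ∀ x y : (ZMod 2)[X], x ^ 8 - y ^ 8 = (x - y) ^ 8 := fun x y =>
      (sub_pow_char_pow (p := 2) (n := 3) x y).symm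
    rw [show n + 1 + i = n + i + 1 by ring, P_succ, P_succ]
    simp only [Polynomial.map_add, Polynomial.map_mul, Polynomial.map_pow, map_X,
      Polynomial.map_one, add_sub_add_right_eq_sub]
    rw [← mul_sub, h, he]
    ring

lemma P_map_pow_add (n s : ℕ) : ∃ e : ℕ, ∀ i : ℕ,
    (P 8 (n + i) ^ 2 ^ s + P 8 n ^ 2 ^ s).map (Int.castRingHom (ZMod 2)) =
      X ^ e * (P 8 i).map (Int.castRingHom (ZMod 2)) ^ (8 ^ n * 2 ^ s) := by
  obtain ⟨e, he⟩ := P_map_sub n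
  refine ⟨e * 2 ^ s, fun i => ?_⟩
  rw [Polynomial.map_add, Polynomial.map_pow, Polynomial.map_pow, ← add_pow_char_pow,
    ← CharTwo.sub_eq_add, he, mul_pow, ← pow_mul, ← pow_mul]

/-- Modulo `P_3`, the critical point has period `3`; the derivative of `P_n` along this cycle is
constant because the cycle is superattracting. -/
lemma exists_P_eq_mul {n : ℕ} (hn : n ≠ 0) : ∃ (ε : ℕ) (g h u : ℤ[X]), ε ≤ 1 ∧
    P 8 n = P 8 3 ^ ε * g ∧ P 8 (n + 3) = P 8 3 ^ ε * h ∧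
    P 8 3 ∣ g - u ∧ P 8 3 ∣ h - u ∧ IsCoprime (P 8 3) u := by
  have step : ∀ p v c : ℤ[X], c ∣ p - v → c ∣ (X * p ^ 8 + 1) - (X * v ^ 8 + 1) := by
    intro p v c h
    rw [add_sub_add_right_eq_sub, ← mul_sub]
    exact (h.trans (sub_dvd_pow_sub_pow p v 8)).mul_left X
  have h1 : ∀ j, P 8 3 ∣ P 8 (3 * j) → P 8 3 ^ 8 ∣ P 8 (3 * j + 1) - 1 := by
    intro j h
    rw [P_succ 8 (3 * j), add_sub_cancel_right]
    exact (pow_dvd_pow_of_dvd h 8).mul_left X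
  have h2 : ∀ j, P 8 3 ∣ P 8 (3 * j) → P 8 3 ^ 8 ∣ P 8 (3 * j + 2) - (X + 1) := by
    intro j h
    rw [P_succ 8 (3 * j + 1)]
    simpa only [one_pow, mul_one] using step _ _ _ (h1 j h)
  have h3 : ∀ j, P 8 3 ∣ P 8 (3 * j) → P 8 3 ^ 8 ∣ P 8 (3 * j + 3) - P 8 3 := by
    intro j h
    rw [P_succ 8 (3 * j + 2)]
    have := step _ _ _ (h2 j h)
    rwa [← P_three] at this
  have h0 : ∀ j, P 8 3 ∣ P 8 (3 * j) := by
    intro j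
    induction j with
    | zero => simp [P_zero]
    | succ j ih =>
      have := (dvd_pow_self (P 8 3) (by norm_num : 8 ≠ 0)).trans (h3 j ih)
      exact (dvd_sub_self_right).1 this
  have hq8 : P 8 3 ∣ P 8 3 ^ 8 := dvd_pow_self _ (by norm_num)
  have h3' : ∀ j, ∃ g, P 8 (3 * j + 3) = P 8 3 ^ 1 * g ∧ P 8 3 ∣ g - 1 := by
    intro j
    obtain ⟨c, hc⟩ := h3 j (h0 j)
    exact ⟨1 + P 8 3 ^ 7 * c, by linear_combination hc, P 8 3 ^ 6 * c, by ring⟩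
  have hcases : (∃ j, n = 3 * j + 1) ∨ (∃ j, n = 3 * j + 2) ∨ ∃ j, n = 3 * j + 3 := by
    have : n = 3 * (n / 3) + n % 3 := by omega
    have : n % 3 < 3 := Nat.mod_lt _ (by norm_num)
    rcases (by omega : n % 3 = 0 ∨ n % 3 = 1 ∨ n % 3 = 2) with h | h | h
    · exact Or.inr (Or.inr ⟨n / 3 - 1, by omega⟩)
    · exact Or.inl ⟨n / 3, by omega⟩
    · exact Or.inr (Or.inl ⟨n / 3, by omega⟩)
  rcases hcases with ⟨j, rfl⟩ | ⟨j, rfl⟩ | ⟨j, rfl⟩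
  · exact ⟨0, _, P 8 (3 * (j + 1) + 1), 1, by norm_num, by simp, by simp [mul_add, add_right_comm], hq8.trans (h1 j (h0 j)),
      hq8.trans (h1 (j + 1) (h0 (j + 1))), isCoprime_one_right⟩
  · refine ⟨0, _, P 8 (3 * (j + 1) + 2), X + 1, by norm_num, by simp,
      by simp [mul_add, add_right_comm], hq8.trans (h2 j (h0 j)),
      -- Bézout: `P_3 - X (X + 1) ^ 7 * (X + 1) = 1`.
      hq8.trans (h2 (j + 1) (h0 (j + 1))), 1, -X * (X + 1) ^ 7, ?_⟩
    rw [P_three]; ring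
  · obtain ⟨g, hg, hg'⟩ := h3' j
    obtain ⟨h, hh, hh'⟩ := h3' (j + 1)
    exact ⟨1, g, h, 1, le_rfl, hg, hh, hg', hh', isCoprime_one_right⟩

lemma irreducible_P_three_map : Irreducible ((P 8 3).map (Int.castRingHom (ZMod 2))) := by
  rw [P_three_map]; exact irreducible_one_add_X_add_X_pow_nine

lemma irreducible_P_three : Irreducible (P 8 3) :=
  (monic_P (by norm_num) (by norm_num)).irreducible_of_irreducible_map
    (Int.castRingHom (ZMod 2)) _ irreducible_P_three_map

lemma not_P_three_map_dvd_X_pow (e : ℕ) :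
    ¬ (P 8 3).map (Int.castRingHom (ZMod 2)) ∣ X ^ e := by
  intro h
  have hc : IsCoprime ((P 8 3).map (Int.castRingHom (ZMod 2))) (X ^ e) := by
    refine IsCoprime.pow_right ⟨1, -(1 + X ^ 8), ?_⟩
    rw [P_three_map]; ring
  exact irreducible_P_three_map.not_isUnit (hc.isUnit_of_dvd h)

/-- Points satisfying the equation for period `1` satisfy the equation for period `3`. -/
lemma P_pow_add_dvd (k : ℕ) {s : ℕ} (hs : s ≤ 2) :
    P 8 (k + 1) ^ 2 ^ s + P 8 k ^ 2 ^ s ∣ P 8 (k + 3) ^ 2 ^ s + P 8 k ^ 2 ^ s := by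
  set c := P 8 (k + 1) ^ 2 ^ s + P 8 k ^ 2 ^ s with hc
  -- Here `s ≤ 2` matters: `2 ^ (s + 1)` divides 8.
  have h8 : ∀ x y : ℤ[X], x ^ 2 ^ s + y ^ 2 ^ s ∣ x ^ 8 - y ^ 8 := by
    intro x y
    interval_cases s
    · exact ⟨(x - y) * (x ^ 2 + y ^ 2) * (x ^ 4 + y ^ 4), by ring⟩
    · exact ⟨(x ^ 2 - y ^ 2) * (x ^ 4 + y ^ 4), by ring⟩
    · exact ⟨x ^ 4 - y ^ 4, by ring⟩
  have h1 : c ∣ P 8 (k + 2) - P 8 (k + 1) := by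
    rw [P_succ 8 (k + 1), P_succ 8 k, add_sub_add_right_eq_sub, ← mul_sub, ← P_succ]
    exact (h8 _ _).mul_left X
  have h2 : c ∣ P 8 (k + 3) - P 8 (k + 2) := by
    rw [P_succ 8 (k + 2), P_succ 8 (k + 1), add_sub_add_right_eq_sub, ← mul_sub, ← P_succ]
    exact (h1.trans (sub_dvd_pow_sub_pow _ _ 8)).mul_left X
  have h3 : c ∣ P 8 (k + 3) ^ 2 ^ s - P 8 (k + 1) ^ 2 ^ s := by
    refine dvd_trans ?_ (sub_dvd_pow_sub_pow _ _ _)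
    simpa using dvd_add h2 h1
  have h4 := dvd_add h3 (dvd_refl c)
  convert h4 using 1
  rw [hc]; ring

/-- The polynomial `R_{k+1,3,2^(s+1)}`, with its factorization, before its roots are
identified. -/
lemma exists_irreducible {k : ℕ} (hk : k ≠ 0) {s : ℕ} (hs : s ≤ 2) :
    ∃ (S : ℤ[X]) (N : ℕ), S.Monic ∧ Irreducible S ∧
      P 8 (k + 3) ^ 2 ^ s + P 8 k ^ 2 ^ s =
        (P 8 (k + 1) ^ 2 ^ s + P 8 k ^ 2 ^ s) * P 8 3 ^ N * S ∧
      ¬ S ∣ P 8 (k + 1) ^ 2 ^ s + P 8 k ^ 2 ^ s ∧ ¬ S ∣ P 8 3 := by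
  have h8 : (8 : ℕ) ≠ 0 := by norm_num
  have hm : 2 ^ s ≠ 0 := by positivity
  have hqm : (P 8 3).Monic := monic_P h8 (by norm_num)
  obtain ⟨ε, g, h, u, hε, hg, hh, hgu, hhu, hu⟩ := exists_P_eq_mul hk
  obtain ⟨e, he⟩ := P_map_pow_add k s
  have he1 := he 1
  rw [P_one h8, Polynomial.map_one, one_pow, mul_one] at he1
  have hQ : P 8 (k + 3) ^ 2 ^ s + P 8 k ^ 2 ^ s =
      P 8 3 ^ (ε * 2 ^ s) * (h ^ 2 ^ s + g ^ 2 ^ s) := by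
    rw [hg, hh, mul_pow, mul_pow, ← pow_mul]; ring
  have hQm : (P 8 (k + 3) ^ 2 ^ s + P 8 k ^ 2 ^ s).Monic := monic_P_pow_add h8 hk (by omega) hm
  have hQ1m : (P 8 (k + 1) ^ 2 ^ s + P 8 k ^ 2 ^ s).Monic :=
    monic_P_pow_add h8 hk (by omega) hm
  obtain ⟨T, hT⟩ := P_pow_add_dvd k hs
  have hnd : ¬ P 8 3 ∣ P 8 (k + 1) ^ 2 ^ s + P 8 k ^ 2 ^ s := fun hd =>
    not_P_three_map_dvd_X_pow e (by rw [← he1]; exact Polynomial.map_dvd _ hd)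
  -- The period-1 factor is a power of `X` mod 2, so the prime `P_3` does not divide it.
  obtain ⟨S, rfl⟩ : P 8 3 ^ (ε * 2 ^ s) ∣ T :=
    irreducible_P_three.prime.pow_dvd_of_dvd_mul_left _ hnd (by
      rw [← hT, hQ]; exact dvd_mul_right _ _)
  have hSm : S.Monic := by
    rw [hT, ← mul_assoc] at hQm
    exact (hQ1m.mul (hqm.pow _)).of_mul_monic_left hQm
  have hSg : S * (P 8 (k + 1) ^ 2 ^ s + P 8 k ^ 2 ^ s) = h ^ 2 ^ s + g ^ 2 ^ s := by
    refine mul_left_cancel₀ (hqm.pow (ε * 2 ^ s)).ne_zero ?_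
    rw [← hQ, hT]; ring
  have hexp : 1 ≤ 8 ^ k - ε := by
    have : 8 ^ 1 ≤ 8 ^ k := Nat.pow_le_pow_right (by norm_num) (Nat.pos_of_ne_zero hk)
    omega
  have hmap : S.map (Int.castRingHom (ZMod 2)) =
      (P 8 3).map (Int.castRingHom (ZMod 2)) ^ ((8 ^ k - ε) * 2 ^ s) := by
    have h3 := he 3
    rw [hT, Polynomial.map_mul, he1, Polynomial.map_mul, Polynomial.map_pow] at h3
    have h3 := mul_left_cancel₀ (pow_ne_zero e X_ne_zero) h3
    refine mul_left_cancel₀ (pow_ne_zero (ε * 2 ^ s) irreducible_P_three_map.ne_zero) ?_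
    rw [h3, ← pow_add, ← add_mul, Nat.add_sub_cancel' (by omega)]
  have hne : ∀ a b : ℤ[X], S ≠ P 8 3 * a + C (((2 : ℕ) : ℤ) ^ 2) * b := by
    refine ne_mul_add_of_dvd_sub (v := u ^ 2 ^ s)
      (T := P 8 (k + 1) ^ 2 ^ s + P 8 k ^ 2 ^ s) irreducible_P_three_map hu.pow_right ?_
    rw [hSg]
    have := dvd_add (hhu.trans (sub_dvd_pow_sub_pow _ _ (2 ^ s)))
      (hgu.trans (sub_dvd_pow_sub_pow _ _ (2 ^ s)))
    convert this using 1
    ring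
  have hNpos : (8 ^ k - ε) * 2 ^ s ≠ 0 := mul_ne_zero (by omega) hm
  have hirr := irreducible_of_map_eq_pow (p := 2) hqm hSm irreducible_P_three_map hNpos hmap hne
  refine ⟨S, ε * 2 ^ s, hSm, hirr, by rw [hT, mul_assoc], fun hd => ?_, fun hd => ?_⟩
  · refine not_P_three_map_dvd_X_pow e ?_
    rw [← he1]
    refine dvd_trans ?_ (Polynomial.map_dvd _ hd)
    rw [hmap]
    exact dvd_pow_self _ hNpos
  · obtain ⟨a, ha⟩ := hirr.dvd_symm irreducible_P_three hd
    exact hne a 0 (by rw [ha]; ring)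

/-! ### From roots of `S` to parameters -/

lemma dvd_of_aeval_eq_zero {S T : ℤ[X]} (hS : S.Monic) (hirr : Irreducible S) {a : ℂ}
    (ha : aeval a S = 0) (hT : aeval a T = 0) : S ∣ T := by
  have hint : IsIntegral ℤ a := ⟨S, hS, by simpa [aeval_def] using ha⟩
  have h1 := minpoly.isIntegrallyClosed_dvd hint ha
  exact ((minpoly.irreducible hint).dvd_symm hirr h1).trans
    (minpoly.isIntegrallyClosed_dvd hint hT)

open Function in
lemma mem_paramSet_iff {k s : ℕ} (hs : s ≤ 2) (a : ℂ) :
    a ∈ paramSet 8 (k + 1) 3 (2 ^ (s + 1)) ↔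
      aeval a (P 8 (k + 3) ^ 2 ^ s + P 8 k ^ 2 ^ s) = 0 ∧
      aeval a (P 8 (k + 1) ^ 2 ^ s + P 8 k ^ 2 ^ s) ≠ 0 ∧ aeval a (P 8 3) ≠ 0 := by
  have hm : 2 ^ s ≠ 0 := by positivity
  have h8 : ∀ x y : ℂ, x ^ 2 ^ s + y ^ 2 ^ s = 0 → x ^ 8 = y ^ 8 := by
    intro x y h
    interval_cases s
    · linear_combination (x - y) * (x ^ 2 + y ^ 2) * (x ^ 4 + y ^ 4) * h
    · linear_combination (x ^ 2 - y ^ 2) * (x ^ 4 + y ^ 4) * h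
    · linear_combination (x ^ 4 - y ^ 4) * h
  have hsucc : ∀ n, (f 8 a)^[n + 1] 0 = a * ((f 8 a)^[n] 0) ^ 8 + 1 := fun n => by
    rw [iterate_succ_apply', f]
  have hadd : ∀ i j, (f 8 a)^[i] ((f 8 a)^[j] 0) = (f 8 a)^[j + i] 0 := fun i j => by
    rw [← iterate_add_apply, add_comm]
  simp only [map_add, map_pow, aeval_P, paramSet, Set.mem_ofPred_eq, HasPreperiodPeriod,
    Nat.add_sub_cancel, show k + 1 + 3 - 1 = k + 3 by omega]
  constructor
  · rintro ⟨⟨-, hper, hpre⟩, ω, hω, hωk⟩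
    have hω1 : ω ^ 2 ^ s = -1 := by
      have h1 : (ω ^ 2 ^ s) ^ 2 = 1 := by rw [← pow_mul, ← pow_succ, hω.pow_eq_one]
      refine (eq_or_eq_neg_of_sq_eq_sq _ 1 (by rw [h1, one_pow])).resolve_left ?_
      exact hω.pow_ne_one_of_pos_of_lt hm (Nat.pow_lt_pow_right (by norm_num) (by omega))
    refine ⟨by rw [hωk, mul_pow, hω1]; ring, fun h => ?_, fun h => ?_⟩
    · have hfix : IsPeriodicPt (f 8 a) 1 ((f 8 a)^[k + 1] 0) := by
        rw [IsPeriodicPt, IsFixedPt, hadd, hsucc, h8 _ _ h, ← hsucc]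
      have := hfix.minimalPeriod_le one_pos
      omega
    · exact hpre 0 (by omega) (mk_mem_periodicPts (n := 3) (by norm_num) h)
  · rintro ⟨h, h1, h3⟩
    have hper : (f 8 a)^[k + 1 + 3] 0 = (f 8 a)^[k + 1] 0 := by
      rw [show k + 1 + 3 = k + 3 + 1 by ring, hsucc, h8 _ _ h, ← hsucc]
    have hk0 : (f 8 a)^[k] 0 ≠ 0 := by
      intro h0
      rw [h0, zero_pow hm, add_zero] at h
      have h0' := pow_eq_zero_iff hm |>.1 h
      rw [← hadd, h0] at h0'
      exact h3 h0'
    have hpt : IsPeriodicPt (f 8 a) 3 ((f 8 a)^[k + 1] 0) := by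
      rw [IsPeriodicPt, IsFixedPt, hadd, hper]
    have hmin : minimalPeriod (f 8 a) ((f 8 a)^[k + 1] 0) = 3 := by
      refine ((Nat.dvd_prime Nat.prime_three).1 hpt.minimalPeriod_dvd).resolve_left fun hone => ?_
      have hfix : f 8 a ((f 8 a)^[k + 1] 0) = (f 8 a)^[k + 1] 0 :=
        minimalPeriod_eq_one_iff_isFixedPt.1 hone
      have h2 : (f 8 a)^[k + 3] 0 = (f 8 a)^[k + 1] 0 := by
        rw [iterate_succ_apply', iterate_succ_apply', hfix, hfix]
      rw [h2] at h
      exact h1 h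
    refine ⟨⟨by norm_num, hmin, fun j hj hjp => ?_⟩, (f 8 a)^[k + 3] 0 / (f 8 a)^[k] 0, ?_, ?_⟩
    -- An earlier periodic point would make `f^k(0)` periodic of the same period 3, so `ω = 1` and
    -- `2 f^k(0) ^ m = 0`.
    · have hkp : (f 8 a)^[k] 0 ∈ periodicPts (f 8 a) := by
        have := (bijOn_periodicPts (f 8 a)).mapsTo.iterate (k - j) hjp
        rwa [hadd, Nat.add_sub_cancel' (by omega)] at this
      have h3p := minimalPeriod_apply hkp
      rw [← iterate_succ_apply' (f 8 a) k, hmin] at h3p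
      have hk3 : (f 8 a)^[k + 3] 0 = (f 8 a)^[k] 0 := by
        have := iterate_minimalPeriod (f := f 8 a) (x := (f 8 a)^[k] 0)
        rwa [← h3p, hadd] at this
      rw [hk3, ← two_mul] at h
      exact hk0 (pow_eq_zero_iff hm |>.1 ((mul_eq_zero.1 h).resolve_left two_ne_zero))
    · have hpow : ((f 8 a)^[k + 3] 0 / (f 8 a)^[k] 0) ^ 2 ^ s = -1 := by
        rw [div_pow, div_eq_iff (pow_ne_zero _ hk0)]
        linear_combination h
      have hord := orderOf_eq_prime_pow (p := 2) (n := s)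
        (x := (f 8 a)^[k + 3] 0 / (f 8 a)^[k] 0) (by rw [hpow]; norm_num)
        (by rw [pow_succ, pow_mul, hpow]; norm_num)
      exact hord ▸ IsPrimitiveRoot.orderOf _
    · rw [div_mul_cancel₀ _ hk0]

lemma paramSet_eq_roots {k s : ℕ} (hk : k ≠ 0) (hs : s ≤ 2) :
    ∃ S : ℤ[X], S.Monic ∧ Irreducible S ∧
      paramSet 8 (k + 1) 3 (2 ^ (s + 1)) = {a | aeval a S = 0} := by
  obtain ⟨S, N, hSm, hirr, hS, h1, h3⟩ := exists_irreducible hk hs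
  refine ⟨S, hSm, hirr, Set.ext fun a => ?_⟩
  rw [mem_paramSet_iff hs, hS, map_mul, map_mul, map_pow, Set.mem_ofPred_eq]
  refine ⟨fun ⟨h, ha1, ha3⟩ => ?_, fun h => ⟨by rw [h, mul_zero], fun ha => ?_, fun ha => ?_⟩⟩
  · exact (mul_eq_zero.1 h).resolve_left (mul_ne_zero ha1 (pow_ne_zero _ ha3))
  · exact h1 (dvd_of_aeval_eq_zero hSm hirr h ha)
  · exact h3 (dvd_of_aeval_eq_zero hSm hirr h ha)

/-- A monic irreducible integer polynomial is the product of the `X - a` over its distinct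
complex roots. -/
lemma map_eq_finprod {S : ℤ[X]} (hS : S.Monic) (hirr : Irreducible S) :
    {a : ℂ | aeval a S = 0}.Finite ∧
      S.map (Int.castRingHom ℂ) = ∏ᶠ a ∈ {a : ℂ | aeval a S = 0}, (X - C a) := by
  have hirrQ : Irreducible (S.map (Int.castRingHom ℚ)) := by
    simpa using (hS.irreducible_iff_irreducible_map_fraction_map (K := ℚ)).1 hirr
  have hmon : (S.map (Int.castRingHom ℂ)).Monic := hS.map _
  have hnodup : (S.map (Int.castRingHom ℂ)).roots.Nodup := by
    have hsep := hirrQ.separable.map (f := algebraMap ℚ ℂ)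
    rw [Polynomial.map_map, RingHom.ext_int ((algebraMap ℚ ℂ).comp (Int.castRingHom ℚ))
      (Int.castRingHom ℂ)] at hsep
    exact nodup_roots hsep
  have hset : {a : ℂ | aeval a S = 0} = ((S.map (Int.castRingHom ℂ)).roots.toFinset : Set ℂ) := by
    ext a
    simp [hmon.ne_zero, aeval_def, eval_map]
  refine ⟨by rw [hset]; exact Finset.finite_toSet _, ?_⟩
  rw [hset, finprod_mem_coe_finset, Finset.prod, Multiset.toFinset_val, hnodup.dedup]
  exact (IsAlgClosed.splits _).eq_prod_roots_of_monic hmon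

end Unicritical

theorem mainTheorem6 :
    (∀ k : ℕ, 2 ≤ k → ∀ d ∈ ({2, 4, 8} : Finset ℕ),
      (Unicritical.paramSet 8 k 3 d).Finite ∧
      ∃ R : Polynomial ℤ,
        R.map (Int.castRingHom ℂ) = Unicritical.Rpre 8 k 3 d ∧
        Irreducible (R.map (Int.castRingHom ℚ))) ∧
    (Unicritical.Rper 8 3).map (Int.castRingHom (ZMod 2)) =
      1 + Polynomial.X + Polynomial.X ^ 9 ∧
    Irreducible ((Unicritical.Rper 8 3).map (Int.castRingHom (ZMod 2))) := by
  rw [Unicritical.Rper_three]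
  refine ⟨fun k hk d hd => ?_, Unicritical.P_three_map, Unicritical.irreducible_P_three_map⟩
  obtain ⟨s, hs, rfl⟩ : ∃ s ≤ 2, d = 2 ^ (s + 1) := by
    simp only [Finset.mem_insert, Finset.mem_singleton] at hd
    rcases hd with rfl | rfl | rfl
    exacts [⟨0, by norm_num, rfl⟩, ⟨1, by norm_num, rfl⟩, ⟨2, le_rfl, rfl⟩]
  -- From here `k` is the preperiod minus one, nonzero because the preperiod is at least 2.
  obtain ⟨k, rfl⟩ : ∃ j, k = j + 1 := ⟨k - 1, by omega⟩
  obtain ⟨S, hSm, hirr, hS⟩ := Unicritical.paramSet_eq_roots (k := k) (by omega) hs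
  obtain ⟨hfin, hprod⟩ := Unicritical.map_eq_finprod hSm hirr
  rw [Unicritical.Rpre, hS]
  exact ⟨hfin, S, hprod, by
    simpa using (hSm.irreducible_iff_irreducible_map_fraction_map (K := ℚ)).1 hirr⟩
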